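/- **Setting.** Let $m\ge 1$, $\kappa>0$. Let $\mathcal T_h$ be a finite matching simplicial mesh in $\mathbb R^m$ (finitely many closed nondegenerate $m$-simplices, any two of which meet exactly in the simplex spanned by their common vertices), and let $\Omega$ be the interior of the union of its cells. Assume that $\mathcal T_h$ is shape regular with parameter $\sigma$, i.e. every cell $K$ contains a ball of diameter $d_K>0$ with $\operatorname{diam}K\le\sigma d_K$, and that $h>0$ is a mesh width with $\operatorname{diam}K\le\rho h$ for all $K\in\mathcal T_h$ (for instance, $h$ is the maximal cell diameter and $\rho=1$; or the mesh is quasi-uniform with ratio $\rho$ and $h$ is the minimal cell diameter). For a union $\Theta$ of cells, let $\mathcal T_h(\Theta)$ be the set of cells contained in $\Theta$ that form it, let $V_h(\Theta)$ be the space of continuous functions on $\Theta$ that are affine on each of these cells, and let $V_h^0(\Theta)$ be the subspace of functions vanishing on $\partial\Theta$. Put $$(u,v)_{ML,\Theta}=\sum_{K\in\mathcal T_h(\Theta)}\int_K \mathcal I_h^K(uv)\,dx,\qquad a_\Theta(u,v)=\int_\Theta\kappa^2\,\nabla u\cdot\nabla v\,dx,$$ where $\mathcal I_h^K f$ is the affine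 function that agrees with $f$ at the vertices of $K$. Let $\Omega_i\subseteq\Omega_i^\delta\subseteq\overline\Omega$ be (closed) unions of cells, the cells of $\Omega_i$ being among those of $\Omega_i^\delta$ (for instance, $\Omega_i^\delta$ arises from $\Omega_i$ by adding layers of cells), and let $\delta\ge0$ be an overlap width: every point of $\Omega_i$ has distance at least $\delta$ from the interface $\partial\Omega_i^\delta\cap\Omega$. **Theorem (exponential decay).** There are constants $\gamma\in(0,1]$ and $\beta>0$, depending only on $m,\kappa,\sigma,\rho$ (in particular not on $\lambda$, $h$, $\delta$, $\Omega$ or the size of $\Omega_i$), such that the following holds for all $\mathcal T_h,h,\Omega_i,\Omega_i^\delta,\delta$ as above and all $\lambda>0$. Let $g\in V_h(\Omega_i^\delta)$ satisfy $g=0$ on $\partial\Omega_i^\delta\cap\partial\Omega$ (it suffices: at those points of this set whose distance to some point of $\Omega_i$ is less than $\delta$). If $z\in V_h(\Omega_i^\delta)$ solves $$(z,\varphi)_{ML,\Omega_i^\delta}+\lambda^2a_{\Omega_i^\delta}(z,\varphi)=0\quad\text{for all }\varphi\in V_h^0(\Omega_i^\delta),\qquad z=g\ \text{ on }\partial\Omega_i^\delta,$$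 then $$\frac1{\lambda^2}(z,z)_{ML,\Omega_i}+a_{\Omega_i}(z,z)\le\beta\exp\Big(-\frac{\gamma\,\delta}{\max\{\lambda,h\}}\Big)\Big(\frac1{\lambda^2}(g,g)_{ML,\Omega_i^\delta}+a_{\Omega_i^\delta}(g,g)\Big).$$ -/

import Mathlib

open MeasureTheory Set

namespace ExpDecay

/-- Euclidean space `ℝ^m`. -/
abbrev Pt (m : ℕ) : Type := EuclideanSpace ℝ (Fin m)

/-- A (finite) matching simplicial mesh in `ℝ^m`. A cell is stored as the set of its `m + 1`
vertices; the closed simplex itself is the convex hull of that set. Two closed simplices meet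
exactly in the simplex spanned by their common vertices (possibly empty). -/
structure SimplicialMesh (m : ℕ) where
  cells : Finset (Finset (Pt m))
  card_eq : ∀ K ∈ cells, K.card = m + 1
  affineIndependent : ∀ K ∈ cells, AffineIndependent ℝ ((↑) : K → Pt m)
  matching : ∀ K ∈ cells, ∀ L ∈ cells,
    convexHull ℝ (K : Set (Pt m)) ∩ convexHull ℝ (L : Set (Pt m)) =
      convexHull ℝ ((K : Set (Pt m)) ∩ (L : Set (Pt m)))

/-- The closed set covered by a collection of cells. -/
def region {m : ℕ} (S : Finset (Finset (Pt m))) : Set (Pt m) :=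
  ⋃ K ∈ S, convexHull ℝ (K : Set (Pt m))

/-- The open domain `Ω` that is triangulated by the mesh. -/
def SimplicialMesh.domain {m : ℕ} (T : SimplicialMesh m) : Set (Pt m) :=
  interior (region T.cells)

/-- Shape regularity with parameter `σ`: every cell contains a ball whose diameter `2 * r` is at
least `1 / σ` times the diameter of the cell. -/
def SimplicialMesh.ShapeRegular {m : ℕ} (T : SimplicialMesh m) (σ : ℝ) : Prop :=
  ∀ K ∈ T.cells, ∃ (c : Pt m) (r : ℝ), 0 < r ∧
    Metric.closedBall c r ⊆ convexHull ℝ (K : Set (Pt m)) ∧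
    Metric.diam (convexHull ℝ (K : Set (Pt m))) ≤ σ * (2 * r)

/-- The space `V_h(Θ)` of continuous piecewise linear functions on the union `Θ` of the cells
in `S`. Only the values on `region S` are relevant. -/
def MemP1 {m : ℕ} (S : Finset (Finset (Pt m))) (u : Pt m → ℝ) : Prop :=
  ContinuousOn u (region S) ∧
    ∀ K ∈ S, ∃ A : Pt m →ᵃ[ℝ] ℝ, EqOn u A (convexHull ℝ (K : Set (Pt m)))

/-- The subspace of `V_h(Θ)` of functions with zero trace on `∂Θ`. -/
def MemP1Zero {m : ℕ} (S : Finset (Finset (Pt m))) (u : Pt m → ℝ) : Prop :=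
  MemP1 S u ∧ ∀ x ∈ frontier (region S), u x = 0

/-- The nodal interpolation on a single cell: the affine function that takes the values of `f`
at the vertices of `K`. For a nondegenerate simplex it exists and is unique, see
`nodalInterp_apply` and `eq_nodalInterp`. -/
noncomputable def nodalInterp {m : ℕ} (K : Finset (Pt m)) (f : Pt m → ℝ) : Pt m →ᵃ[ℝ] ℝ :=
  Classical.epsilon fun A : Pt m →ᵃ[ℝ] ℝ => ∀ p ∈ K, A p = f p

theorem affineSpan_cell {m : ℕ} {K : Finset (Pt m)} (hK : K.card = m + 1)
    (hi : AffineIndependent ℝ ((↑) : K → Pt m)) : affineSpan ℝ (K : Set (Pt m)) = ⊤ := by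
  have h := hi.affineSpan_eq_top_iff_card_eq_finrank_add_one.2 (by simp [hK])
  simpa using h

theorem nodalInterp_apply {m : ℕ} {K : Finset (Pt m)} (hK : K.card = m + 1)
    (hi : AffineIndependent ℝ ((↑) : K → Pt m)) (f : Pt m → ℝ) :
    ∀ p ∈ K, nodalInterp K f p = f p := by
  have hex : ∃ A : Pt m →ᵃ[ℝ] ℝ, ∀ p ∈ K, A p = f p := by
    classical
    let b : AffineBasis K ℝ (Pt m) :=
      ⟨(↑), hi, by simpa using affineSpan_cell hK hi⟩
    refine ⟨∑ i : K, f i • b.coord i, fun p hp => ?_⟩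
    have h1 : (∑ i : K, f i • b.coord i) p = ∑ i : K, f i * b.coord i p := by
      have : ∀ s : Finset K, (∑ i ∈ s, f i • b.coord i) p = ∑ i ∈ s, f i * b.coord i p := by
        intro s
        induction s using Finset.induction_on with
        | empty => simp
        | insert a s ha ih => simp [Finset.sum_insert ha, ih]
      exact this _
    rw [h1]
    have h2 : ∀ i : K, b.coord i p = if i = ⟨p, hp⟩ then 1 else 0 := fun i =>
      b.coord_apply i ⟨p, hp⟩
    simp [h2]
  exact Classical.epsilon_spec hex

theorem eq_nodalInterp {m : ℕ} {K : Finset (Pt m)} (hK : K.card = m + 1)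
    (hi : AffineIndependent ℝ ((↑) : K → Pt m)) {f : Pt m → ℝ} {A : Pt m →ᵃ[ℝ] ℝ}
    (hA : ∀ p ∈ K, A p = f p) : A = nodalInterp K f := by
  refine AffineMap.ext_on (affineSpan_cell hK hi) fun p hp => ?_
  rw [hA p hp, nodalInterp_apply hK hi f p hp]

/-- The mass-lumped inner product `(u, v)_{ML,Θ}`: on each cell, the integral of the nodal
interpolant of the product `u v`. -/
noncomputable def massLumped {m : ℕ} (S : Finset (Finset (Pt m))) (u v : Pt m → ℝ) : ℝ :=
  ∑ K ∈ S, ∫ x in convexHull ℝ (K : Set (Pt m)), nodalInterp K (fun p => u p * v p) x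

/-- The bilinear form `a_Θ(u, v) = ∫_Θ κ² ∇u · ∇v`. For functions in `V_h(Θ)` the pointwise
gradient exists in the interior of every cell, hence almost everywhere in `Θ`, and it is the weak
gradient. -/
noncomputable def stiffness {m : ℕ} (κ : ℝ) (S : Finset (Finset (Pt m))) (u v : Pt m → ℝ) : ℝ :=
  ∫ x in region S, κ ^ 2 * inner ℝ (gradient u x) (gradient v x)

end ExpDecay

/-!
The energy of a discrete solution is localized with an exponential weight. Write
`B(u, v) = (u, v)_{ML} + λ² a(u, v)`, a form on `Ω_i^δ` that depends on nodal values only: the mass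
part is diagonal, and the stiffness part is `κ² |K| ⟨∇u, ∇v⟩` on a cell `K`, with
`∇u = ∑ u_p ∇λ_p` in terms of the barycentric coordinates `λ_p`. Let `M = max(λ, h)` and
`η = exp(α (δ - dist(·, Ω_i))₊ / M)` with a small `α`.

*Coercivity.* Let `I(f)` be the piecewise affine interpolant. On each cell,
`⟨∇z, ∇I(η² z)⟩ = |∇I(η z)|² + ½ ∑_{p,q} ⟨∇λ_p, ∇λ_q⟩ z_p z_q (η_p - η_q)²`
(`inner_sum_sq_weight`). Shape regularity gives `|∇λ_p| diam K ≤ σ`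
(`IsCell.norm_gradVec_bary_le`), and the choice of `η` gives
`(η_p - η_q)² ≤ C α² (diam K / M)² η_p η_q`. As `λ ≤ M`, the remainder is at most `½` of the lumped
mass of `η z` if `α` is small. Here the lumped mass is bounded from below by
`∫_K λ_p ≥ 2^{-(m+1)} |K|` (`IsCell.volume_le_integral_bary`). Hence
`½ B(η z, η z) ≤ B(z, I(η² z))` (`IsCell.nodalForm_weight_le`).

*Test function.* On `∂Ω_i^δ` either `η = 1` or `g = 0`, so `I(η² z) - g` vanishes there and
`B(z, I(η² z)) = B(z, g) ≤ B(g, g)`, the last step by energy minimality of `z`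
(`nodalForm_le_of_orthogonal`). That `I(η² z) - g` vanishes on the whole boundary and not only in
the boundary vertices rests on `mem_interior_region_of_vertex`: the boundary is a union of faces of
cells, by the matching property.

*Conclusion.* On `Ω_i` the weight is the constant `exp(α δ / M)`, so that
`exp(2 α δ / M) B_{Ω_i}(z, z) ≤ B(η z, η z) ≤ 2 B(g, g)`. This is the claim with `γ = 2 α`, `β = 2`.
-/

namespace ExpDecay

open Filter Topology

variable {m : ℕ}

/-! ### Barycentric coordinates and gradients on a cell -/

/-- A nondegenerate `m`-simplex, given by its set of vertices. -/
def IsCell (K : Finset (Pt m)) : Prop :=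
  K.card = m + 1 ∧ AffineIndependent ℝ ((↑) : K → Pt m)

theorem SimplicialMesh.isCell (T : SimplicialMesh m) {K : Finset (Pt m)} (hK : K ∈ T.cells) :
    IsCell K :=
  ⟨T.card_eq K hK, T.affineIndependent K hK⟩

open Classical in
/-- The barycentric coordinate of the cell `K` that belongs to its vertex `p`. It is indexed by
points instead of by the subtype of vertices, so that coordinates of different cells can be
compared; it is zero if `p` is not a vertex of `K`. -/
noncomputable def bary (K : Finset (Pt m)) (p : Pt m) : Pt m →ᵃ[ℝ] ℝ :=
  nodalInterp K fun q => if q = p then 1 else 0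

/-- The (constant) gradient of an affine function. -/
noncomputable def gradVec (A : Pt m →ᵃ[ℝ] ℝ) : Pt m :=
  (InnerProductSpace.toDual ℝ (Pt m)).symm A.linear.toContinuousLinearMap

theorem inner_gradVec (A : Pt m →ᵃ[ℝ] ℝ) (x y : Pt m) : inner ℝ (gradVec A) (x - y) = A x - A y := by
  simp only [gradVec, InnerProductSpace.toDual_symm_apply, LinearMap.coe_toContinuousLinearMap']
  simpa using A.linearMap_vsub x y

theorem hasGradientAt_affine (A : Pt m →ᵃ[ℝ] ℝ) (x : Pt m) : HasGradientAt A (gradVec A) x := by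
  rw [hasGradientAt_iff_hasFDerivAt, gradVec, LinearIsometryEquiv.apply_symm_apply]
  exact (⟨A, A.continuous_of_finiteDimensional⟩ : Pt m →ᴬ[ℝ] ℝ).hasFDerivAt

theorem affine_nonneg_of_mem {A : Pt m →ᵃ[ℝ] ℝ} {s : Set (Pt m)} (hA : ∀ p ∈ s, 0 ≤ A p)
    {x : Pt m} (hx : x ∈ convexHull ℝ s) : 0 ≤ A x := by
  have h : Convex ℝ (A ⁻¹' Ici 0) := (convex_Ici (0 : ℝ)).affine_preimage A
  exact convexHull_min (fun p hp => hA p hp) h hx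

theorem affine_eq_of_mem {A B : Pt m →ᵃ[ℝ] ℝ} {s : Set (Pt m)} (h : ∀ p ∈ s, A p = B p)
    {x : Pt m} (hx : x ∈ convexHull ℝ s) : A x = B x := by
  have h1 : 0 ≤ (A - B) x := affine_nonneg_of_mem (fun p hp => by simp [h p hp]) hx
  have h2 : 0 ≤ (B - A) x := affine_nonneg_of_mem (fun p hp => by simp [h p hp]) hx
  simp only [AffineMap.coe_sub, Pi.sub_apply] at h1 h2
  linarith

section Cell

variable {K : Finset (Pt m)} (hK : IsCell K)

include hK

theorem IsCell.bary_self {p : Pt m} (hp : p ∈ K) : bary K p p = 1 := by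
  simp [bary, nodalInterp_apply hK.1 hK.2 _ p hp]

theorem IsCell.bary_ne {p q : Pt m} (hq : q ∈ K) (h : q ≠ p) : bary K p q = 0 := by
  simp [bary, nodalInterp_apply hK.1 hK.2 _ q hq, h]

theorem IsCell.bary_nonneg (p : Pt m) {x : Pt m} (hx : x ∈ convexHull ℝ (K : Set (Pt m))) :
    0 ≤ bary K p x := by
  refine affine_nonneg_of_mem (fun q hq => ?_) hx
  by_cases h : q = p
  · subst h; simp [hK.bary_self hq]
  · simp [hK.bary_ne hq h]

theorem IsCell.eq_sum_smul {E : Type*} [AddCommGroup E] [Module ℝ E] (A : Pt m →ᵃ[ℝ] E)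
    (x : Pt m) : A x = ∑ p ∈ K, bary K p x • A p := by
  classical
  obtain ⟨p₀, hp₀⟩ : K.Nonempty := by rw [← Finset.card_pos, hK.1]; omega
  let B : Pt m →ᵃ[ℝ] E := ∑ p ∈ K, ((LinearMap.toSpanSingleton ℝ E (A p)).toAffineMap.comp (bary K p))
  have hB : ∀ y, B y = ∑ p ∈ K, bary K p y • A p := by
    intro y
    have : ∀ s : Finset (Pt m),
        (∑ p ∈ s, ((LinearMap.toSpanSingleton ℝ E (A p)).toAffineMap.comp (bary K p))) y
          = ∑ p ∈ s, bary K p y • A p := by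
      intro s
      induction s using Finset.induction_on with
      | empty => simp
      | insert a s ha ih => simp [Finset.sum_insert ha, ih]
    exact this K
  rw [← hB]
  congr 1
  refine AffineMap.ext_on (affineSpan_cell hK.1 hK.2) fun q hq => ?_
  rw [hB, Finset.sum_eq_single_of_mem q hq fun p _ hpq => by simp [hK.bary_ne hq hpq.symm],
    hK.bary_self hq, one_smul]

theorem IsCell.sum_bary (x : Pt m) : ∑ p ∈ K, bary K p x = 1 := by
  simpa using (hK.eq_sum_smul (AffineMap.const ℝ (Pt m) (1 : ℝ)) x).symm

theorem IsCell.bary_le_one {p : Pt m} (hp : p ∈ K) {x : Pt m}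
    (hx : x ∈ convexHull ℝ (K : Set (Pt m))) : bary K p x ≤ 1 := by
  rw [← hK.sum_bary x]
  exact Finset.single_le_sum (f := fun q => bary K q x) (fun q _ => hK.bary_nonneg q hx) hp

theorem IsCell.mem_of_bary_nonneg {x : Pt m} (h : ∀ p ∈ K, 0 ≤ bary K p x) :
    x ∈ convexHull ℝ (K : Set (Pt m)) := by
  have := hK.eq_sum_smul (AffineMap.id ℝ (Pt m)) x
  simp only [AffineMap.id_apply] at this
  rw [this]
  exact (convex_convexHull ℝ _).sum_mem h (hK.sum_bary x) fun p hp => subset_convexHull ℝ _ hp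

omit hK in
theorem isCompact_cell : IsCompact (convexHull ℝ (K : Set (Pt m))) :=
  K.finite_toSet.isCompact_convexHull ℝ

omit hK in
theorem measurableSet_cell : MeasurableSet (convexHull ℝ (K : Set (Pt m))) :=
  isCompact_cell.isClosed.measurableSet

omit hK in
theorem integrableOn_affine (A : Pt m →ᵃ[ℝ] ℝ) :
    IntegrableOn A (convexHull ℝ (K : Set (Pt m))) :=
  A.continuous_of_finiteDimensional.continuousOn.integrableOn_compact isCompact_cell

/-- The homothety of ratio `1/2` about the vertex `p` maps `K` into the part of `K` where the
coordinate of `p` is at least `1/2`. -/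
theorem IsCell.volume_le_integral_bary {p : Pt m} (hp : p ∈ K) :
    (1 / 2 : ℝ) ^ (m + 1) * volume.real (convexHull ℝ (K : Set (Pt m))) ≤
      ∫ x in convexHull ℝ (K : Set (Pt m)), bary K p x := by
  set C := convexHull ℝ (K : Set (Pt m)) with hC
  set H := AffineMap.homothety p (1 / 2 : ℝ) '' C with hH
  have hsub : H ⊆ C := by
    rintro _ ⟨x, hx, rfl⟩
    rw [AffineMap.homothety_eq_lineMap]
    exact (convex_convexHull ℝ _).lineMap_mem (subset_convexHull ℝ _ hp) hx (by norm_num)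
  have hHc : IsCompact H := isCompact_cell.image
    (AffineMap.continuous_of_finiteDimensional _)
  have hvol : volume.real H = (1 / 2 : ℝ) ^ m * volume.real C := by
    rw [Measure.real, hH, Measure.addHaar_image_homothety, ENNReal.toReal_mul, Measure.real]
    simp [abs_of_pos]
  calc (1 / 2 : ℝ) ^ (m + 1) * volume.real C = ∫ _ in H, (1 / 2 : ℝ) := by
        rw [setIntegral_const, hvol, smul_eq_mul]; ring
    _ ≤ ∫ x in H, bary K p x := by
        refine setIntegral_mono_on (integrableOn_const hHc.measure_lt_top.ne)
          ((integrableOn_affine _).mono_set hsub) hHc.isClosed.measurableSet ?_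
        rintro _ ⟨x, hx, rfl⟩
        rw [AffineMap.homothety_eq_lineMap, AffineMap.apply_lineMap, hK.bary_self hp,
          AffineMap.lineMap_apply]
        have := hK.bary_nonneg p hx
        simp only [vsub_eq_sub, smul_eq_mul, vadd_eq_add]
        linarith
    _ ≤ ∫ x in C, bary K p x :=
        setIntegral_mono_set (integrableOn_affine _)
          ((ae_restrict_iff' measurableSet_cell).2 (.of_forall fun x hx => hK.bary_nonneg p hx))
          (.of_forall hsub)

/-- A barycentric coordinate increases from at least `0` to at most `1` along the diameter of an
inscribed ball in the direction of its gradient. -/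
theorem IsCell.norm_gradVec_bary_le {p c : Pt m} (hp : p ∈ K) {r : ℝ} (hr : 0 < r)
    (hball : Metric.closedBall c r ⊆ convexHull ℝ (K : Set (Pt m))) :
    ‖gradVec (bary K p)‖ * (2 * r) ≤ 1 := by
  set G := gradVec (bary K p) with hG
  rcases eq_or_ne G 0 with h0 | h0
  · simp [h0]
  have hn : 0 < ‖G‖ := norm_pos_iff.2 h0
  have hnorm : ‖(r / ‖G‖) • G‖ = r := by
    rw [norm_smul, Real.norm_of_nonneg (by positivity)]; field_simp
  have h1 : c + (r / ‖G‖) • G ∈ convexHull ℝ (K : Set (Pt m)) := hball (by simp [hnorm])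
  have h2 : c - (r / ‖G‖) • G ∈ convexHull ℝ (K : Set (Pt m)) :=
    hball (by simp [hnorm])
  have h3 := inner_gradVec (bary K p) (c + (r / ‖G‖) • G) (c - (r / ‖G‖) • G)
  have h4 : c + (r / ‖G‖) • G - (c - (r / ‖G‖) • G) = (2 * (r / ‖G‖)) • G := by module
  rw [h4, ← hG, real_inner_smul_right, real_inner_self_eq_norm_sq] at h3
  have h5 : 2 * (r / ‖G‖) * ‖G‖ ^ 2 = ‖G‖ * (2 * r) := by field_simp
  have := hK.bary_le_one hp h1
  have := hK.bary_nonneg p h2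
  linarith

/-- The gradient of an affine function in terms of its nodal values. -/
theorem IsCell.gradVec_eq (A : Pt m →ᵃ[ℝ] ℝ) :
    gradVec A = ∑ p ∈ K, A p • gradVec (bary K p) := by
  refine ext_inner_right ℝ fun v => ?_
  have h : ∀ B : Pt m →ᵃ[ℝ] ℝ, inner ℝ (gradVec B) v = B v - B 0 := fun B => by
    simpa using inner_gradVec B v 0
  simp only [sum_inner, real_inner_smul_left, h]
  rw [hK.eq_sum_smul A v, hK.eq_sum_smul A 0, ← Finset.sum_sub_distrib]
  refine Finset.sum_congr rfl fun p _ => ?_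
  simp only [smul_eq_mul]; ring

theorem IsCell.integral_nodalInterp (f : Pt m → ℝ) :
    ∫ x in convexHull ℝ (K : Set (Pt m)), nodalInterp K f x =
      ∑ p ∈ K, f p * ∫ x in convexHull ℝ (K : Set (Pt m)), bary K p x := by
  simp_rw [← integral_const_mul]
  rw [← integral_finsetSum K fun p _ => (integrableOn_affine _).const_mul (f p)]
  refine integral_congr_ae (.of_forall fun x => ?_)
  simp only
  rw [hK.eq_sum_smul (nodalInterp K f) x]
  refine Finset.sum_congr rfl fun p hp => ?_
  rw [nodalInterp_apply hK.1 hK.2 f p hp, smul_eq_mul, mul_comm]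

end Cell

/-! ### The bilinear forms in terms of nodal values -/

/-- The gradient on the cell `K` of the affine function with nodal values `u`. -/
noncomputable def nodalGrad (K : Finset (Pt m)) (u : Pt m → ℝ) : Pt m :=
  ∑ p ∈ K, u p • gradVec (bary K p)

theorem MemP1.mono {S S' : Finset (Finset (Pt m))} {u : Pt m → ℝ} (hu : MemP1 S' u) (h : S ⊆ S') :
    MemP1 S u :=
  ⟨hu.1.mono (biUnion_subset_biUnion_left h), fun K hK => hu.2 K (h hK)⟩

theorem MemP1.sub {S : Finset (Finset (Pt m))} {u v : Pt m → ℝ} (hu : MemP1 S u)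
    (hv : MemP1 S v) : MemP1 S (u - v) := by
  refine ⟨hu.1.sub hv.1, fun K hK => ?_⟩
  obtain ⟨A, hA⟩ := hu.2 K hK
  obtain ⟨B, hB⟩ := hv.2 K hK
  exact ⟨A - B, fun x hx => by simp [hA hx, hB hx]⟩

theorem isClosed_region (S : Finset (Finset (Pt m))) : IsClosed (region S) :=
  S.finite_toSet.isClosed_biUnion fun _ _ => isCompact_cell.isClosed

theorem mem_region_of_mem {S : Finset (Finset (Pt m))} {K : Finset (Pt m)} (hK : K ∈ S) {x : Pt m}
    (hx : x ∈ convexHull ℝ (K : Set (Pt m))) : x ∈ region S :=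
  mem_biUnion hK hx

theorem vertex_mem_cell {K : Finset (Pt m)} {p : Pt m} (hp : p ∈ K) :
    p ∈ convexHull ℝ (K : Set (Pt m)) :=
  subset_convexHull ℝ _ hp

/-- Almost everywhere on a cell, that is, in its interior, a piecewise affine function has the
gradient that is determined by its nodal values. -/
theorem MemP1.gradient_ae_eq (T : SimplicialMesh m) {S : Finset (Finset (Pt m))}
    (hS : S ⊆ T.cells) {u : Pt m → ℝ} (hu : MemP1 S u) {K : Finset (Pt m)} (hK : K ∈ S) :
    ∀ᵐ x, x ∈ convexHull ℝ (K : Set (Pt m)) → gradient u x = nodalGrad K u := by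
  obtain ⟨A, hA⟩ := hu.2 K hK
  have hG : nodalGrad K u = gradVec A := by
    rw [(T.isCell (hS hK)).gradVec_eq A, nodalGrad]
    exact Finset.sum_congr rfl fun p hp => by rw [hA (vertex_mem_cell hp)]
  have hnull := (convex_convexHull ℝ (K : Set (Pt m))).addHaar_frontier volume
  filter_upwards [measure_eq_zero_iff_ae_notMem.1 hnull] with x hx hxK
  have hxi : x ∈ interior (convexHull ℝ (K : Set (Pt m))) := by
    by_contra h
    exact hx ⟨subset_closure hxK, h⟩
  rw [hG]
  refine ((hasGradientAt_affine A x).congr_of_eventuallyEq ?_).gradient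
  filter_upwards [mem_interior_iff_mem_nhds.1 hxi] with y hy using hA hy

/-- Two different cells overlap in a null set, because their intersection is spanned by fewer than
`m + 1` vertices. -/
theorem SimplicialMesh.aedisjoint (T : SimplicialMesh m) {K L : Finset (Pt m)} (hK : K ∈ T.cells)
    (hL : L ∈ T.cells) (hKL : K ≠ L) :
    AEDisjoint volume (convexHull ℝ (K : Set (Pt m))) (convexHull ℝ (L : Set (Pt m))) := by
  have hne : ¬ K ⊆ L := fun h =>
    hKL (Finset.eq_of_subset_of_card_le h (by rw [T.card_eq K hK, T.card_eq L hL]))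
  obtain ⟨p, hpK, hpL⟩ := Finset.not_subset.1 hne
  rw [AEDisjoint, T.matching K hK L hL]
  refine measure_mono_null (convexHull_subset_affineSpan _)
    (Measure.addHaar_affineSubspace volume _ fun htop => ?_)
  have hcell := T.isCell hK
  have h0 : bary K p = AffineMap.const ℝ (Pt m) (0 : ℝ) := by
    refine AffineMap.ext_on htop fun q hq => ?_
    rw [hcell.bary_ne hq.1 (by rintro rfl; exact hpL hq.2)]
    rfl
  have h1 := hcell.bary_self hpK
  rw [h0] at h1
  simp at h1

/-- The mass-lumped inner product in terms of nodal values. -/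
noncomputable def nodalMass (S : Finset (Finset (Pt m))) (u v : Pt m → ℝ) : ℝ :=
  ∑ K ∈ S, ∑ p ∈ K, u p * v p * ∫ x in convexHull ℝ (K : Set (Pt m)), bary K p x

/-- The stiffness form in terms of nodal values. -/
noncomputable def nodalStiffness (κ : ℝ) (S : Finset (Finset (Pt m))) (u v : Pt m → ℝ) : ℝ :=
  ∑ K ∈ S, κ ^ 2 * volume.real (convexHull ℝ (K : Set (Pt m))) *
    inner ℝ (nodalGrad K u) (nodalGrad K v)

theorem massLumped_eq (T : SimplicialMesh m) {S : Finset (Finset (Pt m))}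
    (hS : S ⊆ T.cells) (u v : Pt m → ℝ) : massLumped S u v = nodalMass S u v :=
  Finset.sum_congr rfl fun _ hK => (T.isCell (hS hK)).integral_nodalInterp _

theorem stiffness_eq (T : SimplicialMesh m) (κ : ℝ) {S : Finset (Finset (Pt m))}
    (hS : S ⊆ T.cells) {u v : Pt m → ℝ} (hu : MemP1 S u) (hv : MemP1 S v) :
    stiffness κ S u v = nodalStiffness κ S u v := by
  classical
  set f : Pt m → ℝ := fun x => κ ^ 2 * inner ℝ (gradient u x) (gradient v x) with hf
  have hae : ∀ K ∈ S, ∀ᵐ x, x ∈ convexHull ℝ (K : Set (Pt m)) →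
      f x = κ ^ 2 * inner ℝ (nodalGrad K u) (nodalGrad K v) := fun K hK => by
    filter_upwards [hu.gradient_ae_eq T hS hK, hv.gradient_ae_eq T hS hK] with x h1 h2 hx
    simp only [hf, h1 hx, h2 hx]
  have hint : ∀ K ∈ S, IntegrableOn f (convexHull ℝ (K : Set (Pt m))) := fun K hK =>
    (integrableOn_const isCompact_cell.measure_lt_top.ne).congr_fun_ae
      ((ae_restrict_iff' measurableSet_cell).2 ((hae K hK).mono fun x hx h => (hx h).symm))
  have key : ∀ R : Finset (Finset (Pt m)), R ⊆ S → ∫ x in region R, f x = nodalStiffness κ R u v := by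
    intro R
    induction R using Finset.induction_on with
    | empty => intro; simp [region, nodalStiffness]
    | insert K R hKR ih =>
      intro hR
      have hKS := hR (Finset.mem_insert_self K R)
      have hRS := (Finset.subset_insert K R).trans hR
      have hreg : region (insert K R) = convexHull ℝ (K : Set (Pt m)) ∪ region R := by
        simp [region]
      have hd : AEDisjoint volume (convexHull ℝ (K : Set (Pt m))) (region R) := by
        rw [region, AEDisjoint, inter_iUnion₂]
        refine (measure_biUnion_null_iff R.countable_toSet).2 fun L hL => ?_
        exact T.aedisjoint (hS hKS) (hS (hRS hL)) fun h => hKR (h ▸ hL)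
      rw [hreg, setIntegral_union₀ hd (isClosed_region R).measurableSet.nullMeasurableSet
        (hint K hKS) (integrableOn_finset_iUnion.2 fun L hL => hint L (hRS hL)), ih hRS,
        setIntegral_congr_ae measurableSet_cell (hae K hKS), setIntegral_const]
      simp only [nodalStiffness]
      rw [Finset.sum_insert hKR, smul_eq_mul]
      ring
  exact key S subset_rfl

/-- The bilinear form `(u, v)_{ML} + λ² a(u, v)` in terms of nodal values. -/
noncomputable def nodalForm (κ lam : ℝ) (S : Finset (Finset (Pt m))) (u v : Pt m → ℝ) : ℝ :=
  nodalMass S u v + lam ^ 2 * nodalStiffness κ S u v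

theorem nodalForm_eq_sum (κ lam : ℝ) (S : Finset (Finset (Pt m))) (u v : Pt m → ℝ) :
    nodalForm κ lam S u v = ∑ K ∈ S, nodalForm κ lam {K} u v := by
  simp [nodalForm, nodalMass, nodalStiffness, Finset.mul_sum, Finset.sum_add_distrib]

theorem nodalForm_congr (κ lam : ℝ) {S : Finset (Finset (Pt m))} {u u' v v' : Pt m → ℝ}
    (hu : ∀ K ∈ S, ∀ p ∈ K, u p = u' p) (hv : ∀ K ∈ S, ∀ p ∈ K, v p = v' p) :
    nodalForm κ lam S u v = nodalForm κ lam S u' v' := by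
  have hg : ∀ {w w' : Pt m → ℝ}, (∀ K ∈ S, ∀ p ∈ K, w p = w' p) → ∀ K ∈ S,
      nodalGrad K w = nodalGrad K w' := fun h K hK =>
    Finset.sum_congr rfl fun p hp => by rw [h K hK p hp]
  simp only [nodalForm, nodalMass, nodalStiffness]
  congr 1
  · exact Finset.sum_congr rfl fun K hK => Finset.sum_congr rfl fun p hp => by
      rw [hu K hK p hp, hv K hK p hp]
  · congr 1
    exact Finset.sum_congr rfl fun K hK => by rw [hg hu K hK, hg hv K hK]

theorem nodalForm_comm (κ lam : ℝ) (S : Finset (Finset (Pt m))) (u v : Pt m → ℝ) :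
    nodalForm κ lam S u v = nodalForm κ lam S v u := by
  simp only [nodalForm, nodalMass, nodalStiffness, mul_comm (u _), real_inner_comm]

theorem nodalGrad_sub (K : Finset (Pt m)) (u v : Pt m → ℝ) :
    nodalGrad K (u - v) = nodalGrad K u - nodalGrad K v := by
  simp [nodalGrad, sub_smul]

theorem nodalGrad_smul (K : Finset (Pt m)) (c : ℝ) (u : Pt m → ℝ) :
    nodalGrad K (c • u) = c • nodalGrad K u := by
  simp [nodalGrad, Finset.smul_sum, mul_smul]

theorem nodalForm_sub_right (κ lam : ℝ) (S : Finset (Finset (Pt m))) (u v w : Pt m → ℝ) :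
    nodalForm κ lam S u (v - w) = nodalForm κ lam S u v - nodalForm κ lam S u w := by
  simp only [nodalForm, nodalMass, nodalStiffness, nodalGrad_sub, inner_sub_right, Pi.sub_apply,
    mul_sub, sub_mul, Finset.sum_sub_distrib]
  ring

theorem nodalForm_smul_smul (κ lam c : ℝ) (S : Finset (Finset (Pt m))) (u : Pt m → ℝ) :
    nodalForm κ lam S (c • u) (c • u) = c ^ 2 * nodalForm κ lam S u u := by
  simp only [nodalForm, nodalMass, nodalStiffness, nodalGrad_smul, real_inner_smul_left,
    real_inner_smul_right, Pi.smul_apply, smul_eq_mul, mul_add, Finset.mul_sum]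
  congr 1
  · exact Finset.sum_congr rfl fun K _ => Finset.sum_congr rfl fun p _ => by ring
  · exact Finset.sum_congr rfl fun K _ => by ring

theorem nodalForm_self_nonneg (T : SimplicialMesh m) (κ lam : ℝ) {S : Finset (Finset (Pt m))}
    (hS : S ⊆ T.cells) (u : Pt m → ℝ) : 0 ≤ nodalForm κ lam S u u := by
  refine add_nonneg (Finset.sum_nonneg fun K hK => Finset.sum_nonneg fun p _ => ?_)
    (mul_nonneg (sq_nonneg _) (Finset.sum_nonneg fun K _ => ?_))
  · exact mul_nonneg (mul_self_nonneg _) (setIntegral_nonneg measurableSet_cell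
      fun x hx => (T.isCell (hS hK)).bary_nonneg p hx)
  · exact mul_nonneg (by positivity) real_inner_self_nonneg

/-! ### Boundary values and nodal interpolation -/

/-- If a vertex `p` of a cell `K` lies in the interior of the region, so does every point `x` of `K`
that is not on the face opposite to `p`.

A small multiple of a neighbourhood of `x`, scaled about `p`, is covered by the cells. A cell `L`
that contains the image of `x` has `p` as a vertex by the matching property, the coordinates of `p`
in `K` and `L` agree at that image, and undoing the scaling does not leave `L` near `x`. -/
theorem mem_interior_region_of_vertex (T : SimplicialMesh m) {S : Finset (Finset (Pt m))}
    (hS : S ⊆ T.cells) {K : Finset (Pt m)} (hK : K ∈ S) {p x : Pt m} (hpK : p ∈ K)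
    (hp : p ∈ interior (region S)) (hx : x ∈ convexHull ℝ (K : Set (Pt m)))
    (hpos : 0 < bary K p x) : x ∈ interior (region S) := by
  have hcK := T.isCell (hS hK)
  obtain ⟨ε, hε0, hε1, hε⟩ : ∃ ε : ℝ, 0 < ε ∧ ε < 1 ∧
      AffineMap.lineMap p x ε ∈ interior (region S) := by
    have hc : Continuous fun ε : ℝ => AffineMap.lineMap p x ε := AffineMap.lineMap_continuous
    have h0 : ∀ᶠ ε in 𝓝[>] (0 : ℝ), AffineMap.lineMap p x ε ∈ interior (region S) :=
      (hc.tendsto 0).mono_left nhdsWithin_le_nhds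
        (isOpen_interior.mem_nhds (by simpa using hp))
    have h1 : ∀ᶠ ε in 𝓝[>] (0 : ℝ), ε < 1 :=
      nhdsWithin_le_nhds (Iio_mem_nhds one_pos)
    obtain ⟨ε, ⟨h0, h1⟩, h2⟩ := ((h0.and h1).and self_mem_nhdsWithin).exists
    exact ⟨ε, h2, h1, h0⟩
  have hline : ∀ (A : Pt m →ᵃ[ℝ] ℝ) (y : Pt m),
      A (AffineMap.lineMap p y ε) = (1 - ε) * A p + ε * A y := fun A y => by
    rw [AffineMap.apply_lineMap, AffineMap.lineMap_apply]
    simp only [vsub_eq_sub, smul_eq_mul, vadd_eq_add]; ring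
  have hcont : Continuous fun y : Pt m => AffineMap.lineMap p y ε := by
    exact (AffineMap.homothety p ε).continuous_of_finiteDimensional.congr fun y =>
      AffineMap.homothety_eq_lineMap p ε y ▸ rfl
  have hcell : ∀ L ∈ S, ∀ᶠ y in 𝓝 x,
      AffineMap.lineMap p y ε ∈ convexHull ℝ (L : Set (Pt m)) → y ∈ region S := by
    intro L hL
    by_cases hxL : AffineMap.lineMap p x ε ∈ convexHull ℝ (L : Set (Pt m))
    swap
    · filter_upwards [hcont.continuousAt.preimage_mem_nhds
        (isCompact_cell.isClosed.isOpen_compl.mem_nhds hxL)] with y hy h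
      exact absurd h hy
    have hcL := T.isCell (hS hL)
    have hxK : AffineMap.lineMap p x ε ∈ convexHull ℝ (K : Set (Pt m)) :=
      (convex_convexHull ℝ _).lineMap_mem (vertex_mem_cell hpK) hx ⟨hε0.le, hε1.le⟩
    have hxKL : AffineMap.lineMap p x ε ∈ convexHull ℝ ((K : Set (Pt m)) ∩ L) :=
      T.matching K (hS hK) L (hS hL) ▸ ⟨hxK, hxL⟩
    have hpL : p ∈ L := by
      by_contra hpL
      have h0 := affine_eq_of_mem (A := bary K p) (B := AffineMap.const ℝ (Pt m) (0 : ℝ))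
        (fun q hq => by rw [hcK.bary_ne hq.1 (by rintro rfl; exact hpL hq.2)]; rfl) hxKL
      rw [hline, hcK.bary_self hpK] at h0
      simp only [AffineMap.const_apply] at h0
      nlinarith
    have hpos' : 0 < bary L p x := by
      have h0 := affine_eq_of_mem (A := bary K p) (B := bary L p) (fun q hq => by
        by_cases h : q = p
        · rw [h, hcK.bary_self hpK, hcL.bary_self hpL]
        · rw [hcK.bary_ne hq.1 h, hcL.bary_ne hq.2 h]) hxKL
      rw [hline, hline, hcK.bary_self hpK, hcL.bary_self hpL] at h0
      have : bary K p x = bary L p x := mul_left_cancel₀ hε0.ne' (by linarith)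
      rwa [← this]
    filter_upwards [(bary L p).continuous_of_finiteDimensional.continuousAt.preimage_mem_nhds
      (Ioi_mem_nhds hpos')] with y hy hyL
    refine mem_region_of_mem hL (hcL.mem_of_bary_nonneg fun q hq => ?_)
    by_cases h : q = p
    · rw [h]; exact (show 0 < bary L p y from hy).le
    · have h1 := hcL.bary_nonneg q hyL
      rw [hline, hcL.bary_ne hpL (Ne.symm h), mul_zero, zero_add] at h1
      exact nonneg_of_mul_nonneg_right h1 hε0
  rw [mem_interior_iff_mem_nhds]
  filter_upwards [(eventually_all_finset S).2 hcell,
    hcont.continuousAt.preimage_mem_nhds (isOpen_interior.mem_nhds hε)] with y hy hyr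
  obtain ⟨L, hL, hyL⟩ := mem_iUnion₂.1 (interior_subset hyr)
  exact hy L hL hyL

/-- A piecewise affine function that vanishes at the boundary vertices vanishes on the boundary. -/
theorem MemP1.memP1Zero (T : SimplicialMesh m) {S : Finset (Finset (Pt m))} (hS : S ⊆ T.cells)
    {u : Pt m → ℝ} (hu : MemP1 S u)
    (h0 : ∀ K ∈ S, ∀ p ∈ K, p ∈ frontier (region S) → u p = 0) : MemP1Zero S u := by
  refine ⟨hu, fun x hx => ?_⟩
  have hxr : x ∈ region S := (isClosed_region S).closure_eq ▸ hx.1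
  obtain ⟨K, hK, hxK⟩ := mem_iUnion₂.1 hxr
  have hcK := T.isCell (hS hK)
  obtain ⟨A, hA⟩ := hu.2 K hK
  rw [hA hxK, hcK.eq_sum_smul A x]
  refine Finset.sum_eq_zero fun p hp => ?_
  rcases (hcK.bary_nonneg p hxK).eq_or_lt with h | h
  · rw [← h, zero_smul]
  · have hpf : p ∈ frontier (region S) :=
      ⟨subset_closure (mem_region_of_mem hK (vertex_mem_cell hp)), fun hpi =>
        hx.2 (mem_interior_region_of_vertex T hS hK hp hpi hxK h)⟩
    rw [← hA (vertex_mem_cell hp), h0 K hK p hp hpf, smul_zero]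

open Classical in
/-- The piecewise affine interpolant, on the cells in `S`, of the values of `f` at the vertices. In
a point that several cells share, the choice of the cell does not matter, see
`interpolant_eq`. -/
noncomputable def interpolant (S : Finset (Finset (Pt m))) (f : Pt m → ℝ) (x : Pt m) : ℝ :=
  if h : ∃ K ∈ S, x ∈ convexHull ℝ (K : Set (Pt m)) then nodalInterp h.choose f x else 0

theorem interpolant_eq (T : SimplicialMesh m) {S : Finset (Finset (Pt m))} (hS : S ⊆ T.cells)
    (f : Pt m → ℝ) {K : Finset (Pt m)} (hK : K ∈ S) {x : Pt m}
    (hx : x ∈ convexHull ℝ (K : Set (Pt m))) : interpolant S f x = nodalInterp K f x := by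
  have h : ∃ K ∈ S, x ∈ convexHull ℝ (K : Set (Pt m)) := ⟨K, hK, hx⟩
  rw [interpolant, dif_pos h]
  obtain ⟨hL, hxL⟩ := h.choose_spec
  have hcK := T.isCell (hS hK)
  have hcL := T.isCell (hS hL)
  have hxKL : x ∈ convexHull ℝ ((h.choose : Set (Pt m)) ∩ K) :=
    T.matching _ (hS hL) K (hS hK) ▸ ⟨hxL, hx⟩
  exact affine_eq_of_mem (fun q hq => by
    rw [nodalInterp_apply hcL.1 hcL.2 f q hq.1, nodalInterp_apply hcK.1 hcK.2 f q hq.2]) hxKL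

theorem interpolant_vertex (T : SimplicialMesh m) {S : Finset (Finset (Pt m))} (hS : S ⊆ T.cells)
    (f : Pt m → ℝ) {K : Finset (Pt m)} (hK : K ∈ S) {p : Pt m} (hp : p ∈ K) :
    interpolant S f p = f p := by
  have hcK := T.isCell (hS hK)
  rw [interpolant_eq T hS f hK (vertex_mem_cell hp), nodalInterp_apply hcK.1 hcK.2 f p hp]

theorem memP1_interpolant (T : SimplicialMesh m) {S : Finset (Finset (Pt m))} (hS : S ⊆ T.cells)
    (f : Pt m → ℝ) : MemP1 S (interpolant S f) := by
  classical
  refine ⟨?_, fun K hK => ⟨nodalInterp K f, fun x hx => interpolant_eq T hS f hK hx⟩⟩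
  have key : ∀ R ⊆ S, ContinuousOn (interpolant S f) (region R) := by
    intro R
    induction R using Finset.induction_on with
    | empty => intro; simp [region]
    | insert K R _ ih =>
      intro hR
      have hreg : region (insert K R) = convexHull ℝ (K : Set (Pt m)) ∪ region R := by
        simp [region]
      rw [hreg]
      refine ContinuousOn.union_of_isClosed ?_ (ih ((Finset.subset_insert K R).trans hR))
        isCompact_cell.isClosed (isClosed_region R)
      exact (nodalInterp K f).continuous_of_finiteDimensional.continuousOn.congr fun x hx =>
        interpolant_eq T hS f (hR (Finset.mem_insert_self K R)) hx
  exact key S subset_rfl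

/-! ### The weighted energy estimate on a cell -/

/-- The discrete product rule behind the decay estimate: moving a factor `η` from the second to
the first argument of a symmetric form costs only squares of differences of `η`. -/
theorem inner_sum_sq_weight {ι E : Type*} [NormedAddCommGroup E] [InnerProductSpace ℝ E]
    (s : Finset ι) (G : ι → E) (u η : ι → ℝ) :
    inner ℝ (∑ p ∈ s, u p • G p) (∑ p ∈ s, (η * (η * u)) p • G p) =
      inner ℝ (∑ p ∈ s, (η * u) p • G p) (∑ p ∈ s, (η * u) p • G p) +
        1 / 2 * ∑ p ∈ s, ∑ q ∈ s, inner ℝ (G p) (G q) * (u p * u q * (η p - η q) ^ 2) := by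
  have hexp : ∀ a b : ι → ℝ, inner ℝ (∑ p ∈ s, a p • G p) (∑ p ∈ s, b p • G p) =
      ∑ p ∈ s, ∑ q ∈ s, inner ℝ (G p) (G q) * (a p * b q) := fun a b => by
    rw [sum_inner]
    refine Finset.sum_congr rfl fun p _ => ?_
    rw [inner_sum]
    refine Finset.sum_congr rfl fun q _ => ?_
    rw [real_inner_smul_left, real_inner_smul_right]; ring
  have hsymm : ∑ p ∈ s, ∑ q ∈ s, inner ℝ (G p) (G q) * (u p * (η * (η * u)) q) =
      ∑ p ∈ s, ∑ q ∈ s, inner ℝ (G p) (G q) * ((η * (η * u)) p * u q) := by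
    rw [Finset.sum_comm]
    refine Finset.sum_congr rfl fun p _ => Finset.sum_congr rfl fun q _ => ?_
    rw [real_inner_comm]; ring
  have hsum : ∑ p ∈ s, ∑ q ∈ s, inner ℝ (G p) (G q) * (u p * u q * (η p - η q) ^ 2) =
      ∑ p ∈ s, ∑ q ∈ s, inner ℝ (G p) (G q) * (u p * (η * (η * u)) q) +
      ∑ p ∈ s, ∑ q ∈ s, inner ℝ (G p) (G q) * ((η * (η * u)) p * u q) -
      2 * ∑ p ∈ s, ∑ q ∈ s, inner ℝ (G p) (G q) * ((η * u) p * (η * u) q) := by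
    simp only [Finset.mul_sum, ← Finset.sum_add_distrib, ← Finset.sum_sub_distrib]
    refine Finset.sum_congr rfl fun p _ => Finset.sum_congr rfl fun q _ => ?_
    simp only [Pi.mul_apply]; ring
  rw [hexp, hexp, hsum, ← hsymm]
  ring

theorem sq_exp_sub_exp_le (a b : ℝ) :
    (Real.exp a - Real.exp b) ^ 2 ≤
      (a - b) ^ 2 * Real.exp |a - b| * (Real.exp a * Real.exp b) := by
  wlog h : b ≤ a generalizing a b
  · have := this b a (le_of_not_ge h)
    rw [abs_sub_comm b a] at this
    linarith
  have h1 : Real.exp b = Real.exp a * Real.exp (-(a - b)) := by rw [← Real.exp_add]; ring_nf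
  have h2 : 1 - (a - b) ≤ Real.exp (-(a - b)) := by linarith [Real.add_one_le_exp (-(a - b))]
  have h3 : Real.exp a - Real.exp b ≤ Real.exp a * (a - b) := by
    rw [h1]; nlinarith [Real.exp_pos a]
  have h4 : 0 ≤ Real.exp a - Real.exp b := sub_nonneg.2 (Real.exp_le_exp.2 h)
  have h5 : Real.exp (a - b) * Real.exp b = Real.exp a := by rw [← Real.exp_add]; ring_nf
  rw [abs_of_nonneg (sub_nonneg.2 h)]
  calc _ ≤ (Real.exp a * (a - b)) ^ 2 := pow_le_pow_left₀ h4 h3 2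
    _ = (a - b) ^ 2 * Real.exp a * (Real.exp (a - b) * Real.exp b) := by rw [h5]; ring
    _ = _ := by ring

/-- Weighted coercivity on a cell: if `η` varies little on `K`, then testing `u` with the
interpolant of `η² u` controls half of the energy of the interpolant of `η u`. The indefinite
remainder of the discrete product rule is absorbed by the lumped mass. -/
theorem IsCell.nodalForm_weight_le {K : Finset (Pt m)} (hK : IsCell K) (κ lam τ : ℝ)
    (u η : Pt m → ℝ) (hη : ∀ p ∈ K, 0 < η p)
    (hτ : ∀ p ∈ K, ∀ q ∈ K, lam ^ 2 * κ ^ 2 * (‖gradVec (bary K p)‖ * ‖gradVec (bary K q)‖) *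
      (η p - η q) ^ 2 ≤ τ * (η p * η q))
    (hτm : τ * (m + 1) ≤ (1 / 2 : ℝ) ^ (m + 1)) :
    1 / 2 * nodalForm κ lam {K} (η * u) (η * u) ≤ nodalForm κ lam {K} u (η * (η * u)) := by
  set V := volume.real (convexHull ℝ (K : Set (Pt m))) with hV
  have hV0 : 0 ≤ V := measureReal_nonneg
  set w := η * u with hw
  set E := ∑ p ∈ K, ∑ q ∈ K, inner ℝ (gradVec (bary K p)) (gradVec (bary K q)) *
    (u p * u q * (η p - η q) ^ 2) with hE
  set M := ∑ p ∈ K, w p * w p * ∫ x in convexHull ℝ (K : Set (Pt m)), bary K p x with hM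
  have hmass : V * (τ * (m + 1) * ∑ p ∈ K, w p ^ 2) ≤ M := by
    rw [hM, Finset.mul_sum, Finset.mul_sum]
    refine Finset.sum_le_sum fun p hp => ?_
    calc V * (τ * (m + 1) * w p ^ 2) = w p * w p * (τ * (m + 1) * V) := by ring
      _ ≤ w p * w p * ((1 / 2 : ℝ) ^ (m + 1) * V) := by gcongr; exact mul_self_nonneg _
      _ ≤ _ := mul_le_mul_of_nonneg_left (hK.volume_le_integral_bary hp) (mul_self_nonneg _)
  have hτ0 : 0 ≤ τ := by
    obtain ⟨p, hp⟩ : K.Nonempty := by rw [← Finset.card_pos, hK.1]; omega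
    have h1 := hτ p hp p hp
    simp only [sub_self] at h1
    have h2 := mul_pos (hη p hp) (hη p hp)
    by_contra h
    nlinarith
  have hErr : lam ^ 2 * κ ^ 2 * -E ≤ τ * (m + 1) * ∑ p ∈ K, w p ^ 2 := by
    calc lam ^ 2 * κ ^ 2 * -E ≤ ∑ p ∈ K, ∑ q ∈ K, τ * (|w p| * |w q|) := by
          rw [hE, ← Finset.sum_neg_distrib, Finset.mul_sum]
          refine Finset.sum_le_sum fun p hp => ?_
          rw [← Finset.sum_neg_distrib, Finset.mul_sum]
          refine Finset.sum_le_sum fun q hq => ?_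
          have hin := abs_real_inner_le_norm (gradVec (bary K p)) (gradVec (bary K q))
          calc _ ≤ |lam ^ 2 * κ ^ 2 * -(inner ℝ (gradVec (bary K p)) (gradVec (bary K q)) *
                (u p * u q * (η p - η q) ^ 2))| := le_abs_self _
            _ = lam ^ 2 * κ ^ 2 * |inner ℝ (gradVec (bary K p)) (gradVec (bary K q))| *
                (η p - η q) ^ 2 * (|u p| * |u q|) := by
              simp only [abs_mul, abs_neg, abs_pow, sq_abs]; ring
            _ ≤ lam ^ 2 * κ ^ 2 * (‖gradVec (bary K p)‖ * ‖gradVec (bary K q)‖) *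
                (η p - η q) ^ 2 * (|u p| * |u q|) := by gcongr
            _ ≤ τ * (η p * η q) * (|u p| * |u q|) :=
              mul_le_mul_of_nonneg_right (hτ p hp q hq) (by positivity)
            _ = τ * (|w p| * |w q|) := by
              simp only [hw, Pi.mul_apply, abs_mul, abs_of_pos (hη p hp), abs_of_pos (hη q hq)]
              ring
      _ = τ * (∑ p ∈ K, |w p|) ^ 2 := by
          rw [sq, Finset.sum_mul_sum, Finset.mul_sum]
          simp only [Finset.mul_sum]
      _ ≤ τ * ((m + 1) * ∑ p ∈ K, w p ^ 2) := by
          refine mul_le_mul_of_nonneg_left ?_ hτ0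
          have := sq_sum_le_card_mul_sum_sq (s := K) (f := fun p => |w p|)
          simpa [hK.1, sq_abs] using this
      _ = _ := by ring
  have h1 : nodalForm κ lam {K} w w =
      M + lam ^ 2 * (κ ^ 2 * V * inner ℝ (nodalGrad K w) (nodalGrad K w)) := by
    simp [nodalForm, nodalMass, nodalStiffness, hM, hV]
  have h2 : nodalForm κ lam {K} u (η * w) =
      M + lam ^ 2 * (κ ^ 2 * V * (inner ℝ (nodalGrad K w) (nodalGrad K w) + 1 / 2 * E)) := by
    simp only [nodalForm, nodalMass, nodalStiffness, Finset.sum_singleton]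
    rw [hw, nodalGrad, nodalGrad, inner_sum_sq_weight]
    congr 1
    refine Finset.sum_congr rfl fun p _ => ?_
    simp only [hw, Pi.mul_apply]; ring
  rw [h1, h2]
  have h3 := mul_le_mul_of_nonneg_left hErr hV0
  have h4 : 0 ≤ lam ^ 2 * (κ ^ 2 * V * inner ℝ (nodalGrad K w) (nodalGrad K w)) :=
    mul_nonneg (sq_nonneg _) (mul_nonneg (by positivity) real_inner_self_nonneg)
  nlinarith

/-- On a shape regular cell, an exponential weight whose exponent `s` has the small Lipschitz
constant `α / M`, with `M` at least `λ` and at least the mesh width, varies little relative to the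
size of the gradients of the barycentric coordinates. -/
theorem IsCell.exp_weight_variation {K : Finset (Pt m)} (hK : IsCell K) {κ lam h M σ ρ α r : ℝ}
    {c : Pt m} (hlam : 0 < lam) (hlM : lam ≤ M) (hhM : h ≤ M) (hα1 : α ≤ 1)
    (hr : 0 < r) (hball : Metric.closedBall c r ⊆ convexHull ℝ (K : Set (Pt m)))
    (hσ : Metric.diam (convexHull ℝ (K : Set (Pt m))) ≤ σ * (2 * r))
    (hρ : Metric.diam (convexHull ℝ (K : Set (Pt m))) ≤ ρ * h) (hh : 0 < h)
    {s : Pt m → ℝ} (hs : ∀ x y, |s x - s y| ≤ α / M * dist x y) {p q : Pt m} (hp : p ∈ K)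
    (hq : q ∈ K) :
    lam ^ 2 * κ ^ 2 * (‖gradVec (bary K p)‖ * ‖gradVec (bary K q)‖) *
      (Real.exp (s p) - Real.exp (s q)) ^ 2 ≤
      κ ^ 2 * α ^ 2 * σ ^ 2 * Real.exp |ρ| * (Real.exp (s p) * Real.exp (s q)) := by
  have hM : 0 < M := hlam.trans_le hlM
  set d := dist p q with hd
  have hd0 : 0 ≤ d := dist_nonneg
  have hdiam : d ≤ Metric.diam (convexHull ℝ (K : Set (Pt m))) :=
    Metric.dist_le_diam_of_mem isCompact_cell.isBounded (vertex_mem_cell hp) (vertex_mem_cell hq)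
  have hσ0 : 0 ≤ σ := by
    by_contra h
    nlinarith [hd0.trans (hdiam.trans hσ)]
  have hG : ∀ p ∈ K, ‖gradVec (bary K p)‖ * d ≤ σ := fun p hp => by
    calc ‖gradVec (bary K p)‖ * d ≤ ‖gradVec (bary K p)‖ * (σ * (2 * r)) := by
          gcongr; exact hdiam.trans hσ
      _ = σ * (‖gradVec (bary K p)‖ * (2 * r)) := by ring
      _ ≤ σ * 1 := by gcongr; exact hK.norm_gradVec_bary_le hp hr hball
      _ = σ := mul_one σ
  have hdM : d / M ≤ |ρ| := by
    rw [div_le_iff₀ hM]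
    calc d ≤ ρ * h := hdiam.trans hρ
      _ ≤ |ρ| * M := mul_le_mul (le_abs_self ρ) hhM hh.le (abs_nonneg ρ)
  have hsd : |s p - s q| ≤ α * (d / M) := (hs p q).trans_eq (by ring)
  have hsρ : |s p - s q| ≤ |ρ| :=
    hsd.trans ((mul_le_of_le_one_left (by positivity) hα1).trans hdM)
  have hsq : (s p - s q) ^ 2 ≤ (α * (d / M)) ^ 2 := by
    rw [← sq_abs]; exact pow_le_pow_left₀ (abs_nonneg _) hsd 2
  have hlM1 : lam / M ≤ 1 := (div_le_one hM).2 hlM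
  set e := Real.exp (s p) * Real.exp (s q) with he
  calc _ ≤ lam ^ 2 * κ ^ 2 * (‖gradVec (bary K p)‖ * ‖gradVec (bary K q)‖) *
        ((α * (d / M)) ^ 2 * Real.exp |ρ| * e) := by
        gcongr
        exact (sq_exp_sub_exp_le _ _).trans (by gcongr)
    _ = κ ^ 2 * α ^ 2 * (lam / M) ^ 2 * ((‖gradVec (bary K p)‖ * d) * (‖gradVec (bary K q)‖ * d)) *
        Real.exp |ρ| * e := by field_simp
    _ ≤ κ ^ 2 * α ^ 2 * 1 ^ 2 * (σ * σ) * Real.exp |ρ| * e := by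
        gcongr
        · exact hG p hp
        · exact hG q hq
    _ = _ := by ring

/-! ### Energy minimality, the weight, and exponential decay -/

/-- Energy minimality of the discrete solution, in the form of a bound for `B(z, g)`. -/
theorem nodalForm_le_of_orthogonal (T : SimplicialMesh m) (κ lam : ℝ)
    {S : Finset (Finset (Pt m))} (hS : S ⊆ T.cells) {z g : Pt m → ℝ}
    (h : nodalForm κ lam S z (z - g) = 0) : nodalForm κ lam S z g ≤ nodalForm κ lam S g g := by
  have h1 := nodalForm_self_nonneg T κ lam hS (z - g)
  rw [nodalForm_sub_right] at h h1
  rw [nodalForm_comm, nodalForm_comm _ _ _ (z - g) g, nodalForm_sub_right, nodalForm_sub_right,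
    nodalForm_comm κ lam S g z] at h1
  linarith

theorem weight_lipschitz (R : Set (Pt m)) (δ : ℝ) {c : ℝ} (hc : 0 ≤ c) (x y : Pt m) :
    |c * max (δ - Metric.infDist x R) 0 - c * max (δ - Metric.infDist y R) 0| ≤ c * dist x y := by
  rw [← mul_sub, abs_mul, abs_of_nonneg hc]
  refine mul_le_mul_of_nonneg_left ((abs_max_sub_max_le_abs _ _ _).trans ?_) hc
  rw [show δ - Metric.infDist x R - (δ - Metric.infDist y R) =
    -(Metric.infDist x R - Metric.infDist y R) by ring, abs_neg, ← Real.dist_eq]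
  exact (Metric.lipschitz_infDist_pt R).dist_le_mul x y |>.trans_eq (by simp)

end ExpDecay

theorem theorem6p3 (m : ℕ) (hm : 1 ≤ m) (κ : ℝ) (hκ : 0 < κ) (σ ρ : ℝ) :
    ∃ γ β : ℝ, 0 < γ ∧ γ ≤ 1 ∧ 0 < β ∧
      -- `T` is the mesh of `Ω`, with mesh width `h`
      ∀ (T : ExpDecay.SimplicialMesh m) (h : ℝ), T.ShapeRegular σ → 0 < h →
        (∀ K ∈ T.cells, Metric.diam (convexHull ℝ (K : Set (ExpDecay.Pt m))) ≤ ρ * h) →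
      -- `S` are the cells of the subdomain `Ω_i`, `S'` those of the overlapping one `Ω_i^δ`
      ∀ (S S' : Finset (Finset (ExpDecay.Pt m))), S ⊆ S' → S' ⊆ T.cells →
      -- `Ω_i` has distance at least `δ` from the interface, the part of `∂Ω_i^δ` inside `Ω`
      ∀ δ : ℝ, 0 ≤ δ →
        (∀ x ∈ ExpDecay.region S,
          ∀ y ∈ frontier (ExpDecay.region S') ∩ T.domain, δ ≤ dist x y) →
      ∀ lam : ℝ, 0 < lam →
      ∀ g z : ExpDecay.Pt m → ℝ, ExpDecay.MemP1 S' g → ExpDecay.MemP1 S' z →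
        -- homogeneous boundary values where `∂Ω_i^δ` runs along `∂Ω` closer than `δ` to `Ω_i`
        (∀ x ∈ ExpDecay.region S,
          ∀ y ∈ frontier (ExpDecay.region S') \ T.domain, dist x y < δ → g y = 0) →
        (∀ φ : ExpDecay.Pt m → ℝ, ExpDecay.MemP1Zero S' φ →
          ExpDecay.massLumped S' z φ + lam ^ 2 * ExpDecay.stiffness κ S' z φ = 0) →
        (∀ x ∈ frontier (ExpDecay.region S'), z x = g x) →
        1 / lam ^ 2 * ExpDecay.massLumped S z z + ExpDecay.stiffness κ S z z ≤
          β * Real.exp (-(γ * δ / max lam h)) *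
            (1 / lam ^ 2 * ExpDecay.massLumped S' g g + ExpDecay.stiffness κ S' g g) := by
  classical
  -- `α` is chosen such that the remainder of the discrete product rule is at most half of the
  -- lumped mass on every cell.
  set X : ℝ := κ ^ 2 * σ ^ 2 * Real.exp |ρ| * (m + 1) * 2 ^ (m + 1) with hX
  have hX0 : 0 ≤ X := by positivity
  set α : ℝ := 1 / (2 + X) with hα
  have hα0 : 0 < α := by positivity
  have hα2 : α ≤ 1 / 2 := one_div_le_one_div_of_le two_pos (by linarith)
  have hαX : α * X ≤ 1 := by
    rw [hα, one_div_mul_eq_div, div_le_one (by positivity)]; linarith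
  have hτm : κ ^ 2 * α ^ 2 * σ ^ 2 * Real.exp |ρ| * (m + 1) ≤ (1 / 2 : ℝ) ^ (m + 1) := by
    have h1 : α * (α * X) ≤ 1 := mul_le_one₀ (by linarith) (by positivity) hαX
    rw [one_div_pow (2 : ℝ), le_div_iff₀ (by positivity)]
    calc _ = α * (α * X) := by rw [hX]; ring
      _ ≤ 1 := h1
  refine ⟨2 * α, 2, by positivity, by linarith, two_pos, ?_⟩
  intro T h hreg hh hdiam S S' hSS' hS'T δ hδ hdist lam hlam g z hg hz hgbd hsol hzg
  have hST := hSS'.trans hS'T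
  set M := max lam h with hM
  have hM0 : 0 < M := hlam.trans_le (le_max_left _ _)
  -- All forms are expressed through nodal values.
  have henergy : ∀ (R : Finset (Finset (ExpDecay.Pt m))) (u : ExpDecay.Pt m → ℝ), R ⊆ T.cells →
      ExpDecay.MemP1 R u → 1 / lam ^ 2 * ExpDecay.massLumped R u u + ExpDecay.stiffness κ R u u =
        1 / lam ^ 2 * ExpDecay.nodalForm κ lam R u u := fun R u hR hu => by
    rw [ExpDecay.massLumped_eq T hR, ExpDecay.stiffness_eq T κ hR hu hu, ExpDecay.nodalForm]
    field_simp
  have horth : ∀ φ, ExpDecay.MemP1Zero S' φ → ExpDecay.nodalForm κ lam S' z φ = 0 := fun φ hφ => by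
    rw [ExpDecay.nodalForm, ← ExpDecay.massLumped_eq T hS'T,
      ← ExpDecay.stiffness_eq T κ hS'T hz hφ.1]
    exact hsol φ hφ
  rw [henergy S z hST (hz.mono hSS'), henergy S' g hS'T hg]
  have hgg := ExpDecay.nodalForm_self_nonneg T κ lam hS'T g
  rcases S.eq_empty_or_nonempty with rfl | ⟨K₀, hK₀⟩
  · rw [show ExpDecay.nodalForm κ lam ∅ z z = 0 by
      simp [ExpDecay.nodalForm, ExpDecay.nodalMass, ExpDecay.nodalStiffness], mul_zero]
    positivity
  have hRne : (ExpDecay.region S).Nonempty := by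
    obtain ⟨p, hp⟩ : K₀.Nonempty := by rw [← Finset.card_pos, T.card_eq K₀ (hST hK₀)]; omega
    exact ⟨p, ExpDecay.mem_region_of_mem hK₀ (ExpDecay.vertex_mem_cell hp)⟩
  -- The weight is largest on `Ω_i` and equal to `1` at distance at least `δ` from it.
  set s : ExpDecay.Pt m → ℝ := fun x =>
    α / M * max (δ - Metric.infDist x (ExpDecay.region S)) 0 with hs
  set η : ExpDecay.Pt m → ℝ := fun x => Real.exp (s x) with hη
  -- On the boundary either `η = 1` or `g = 0`, so the interpolant of `η² z` has boundary values `g`.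
  have hbd : ∀ x ∈ frontier (ExpDecay.region S'), (η * (η * z)) x = g x := by
    intro x hx
    simp only [Pi.mul_apply, hzg x hx]
    by_cases hx' : δ ≤ Metric.infDist x (ExpDecay.region S)
    · have : η x = 1 := by simp [hη, hs, max_eq_right (sub_nonpos.2 hx')]
      simp [this]
    · obtain ⟨y, hy, hxy⟩ := (Metric.infDist_lt_iff hRne).1 (not_le.1 hx')
      rw [dist_comm] at hxy
      have hxT : x ∉ T.domain := fun hxT => (hdist y hy x ⟨hx, hxT⟩).not_gt hxy
      simp [hgbd y hy x ⟨hx, hxT⟩ hxy]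
  have hzgzero : ExpDecay.MemP1Zero S' (z - g) :=
    ⟨hz.sub hg, fun x hx => by simp [hzg x hx]⟩
  have hφzero : ExpDecay.MemP1Zero S' (ExpDecay.interpolant S' (η * (η * z)) - g) :=
    ((ExpDecay.memP1_interpolant T hS'T _).sub hg).memP1Zero T hS'T fun K hK p hp hpf => by
      rw [Pi.sub_apply, ExpDecay.interpolant_vertex T hS'T _ hK hp, hbd p hpf, sub_self]
  have htest : ExpDecay.nodalForm κ lam S' z (η * (η * z)) = ExpDecay.nodalForm κ lam S' z g := by
    have h1 := horth _ hφzero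
    rw [ExpDecay.nodalForm_sub_right, sub_eq_zero] at h1
    rw [← h1]
    exact ExpDecay.nodalForm_congr κ lam (fun _ _ _ _ => rfl) fun K hK p hp =>
      (ExpDecay.interpolant_vertex T hS'T _ hK hp).symm
  have hupper := ExpDecay.nodalForm_le_of_orthogonal T κ lam hS'T (horth _ hzgzero)
  have hcoer : 1 / 2 * ExpDecay.nodalForm κ lam S' (η * z) (η * z) ≤
      ExpDecay.nodalForm κ lam S' z (η * (η * z)) := by
    rw [ExpDecay.nodalForm_eq_sum, ExpDecay.nodalForm_eq_sum κ lam S' z, Finset.mul_sum]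
    refine Finset.sum_le_sum fun K hK => ?_
    obtain ⟨c, r, hr, hball, hσ⟩ := hreg K (hS'T hK)
    have hcK := T.isCell (hS'T hK)
    exact hcK.nodalForm_weight_le κ lam _ z η (fun p _ => Real.exp_pos _) (fun p hp q hq =>
      hcK.exp_weight_variation hlam (le_max_left _ _) (le_max_right _ _) (by linarith) hr hball hσ
        (hdiam K (hS'T hK)) hh (ExpDecay.weight_lipschitz _ δ (by positivity)) hp hq) hτm
  have hrestrict : ExpDecay.nodalForm κ lam S (η * z) (η * z) ≤
      ExpDecay.nodalForm κ lam S' (η * z) (η * z) := by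
    rw [ExpDecay.nodalForm_eq_sum, ExpDecay.nodalForm_eq_sum κ lam S']
    exact Finset.sum_le_sum_of_subset_of_nonneg hSS' fun K hK _ =>
      ExpDecay.nodalForm_self_nonneg T κ lam (Finset.singleton_subset_iff.2 (hS'T hK)) _
  have hconst : ExpDecay.nodalForm κ lam S (η * z) (η * z) =
      Real.exp (α * δ / M) ^ 2 * ExpDecay.nodalForm κ lam S z z := by
    have hval : ∀ K ∈ S, ∀ p ∈ K, (η * z) p = (Real.exp (α * δ / M) • z) p := fun K hK p hp => by
      have h0 := Metric.infDist_zero_of_mem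
        (ExpDecay.mem_region_of_mem hK (ExpDecay.vertex_mem_cell hp))
      simp only [hη, hs, Pi.mul_apply, Pi.smul_apply, smul_eq_mul, h0, sub_zero, max_eq_left hδ]
      rw [div_mul_eq_mul_div]
    rw [ExpDecay.nodalForm_congr κ lam hval hval, ExpDecay.nodalForm_smul_smul]
  have hmain : Real.exp (α * δ / M) ^ 2 * ExpDecay.nodalForm κ lam S z z ≤
      2 * ExpDecay.nodalForm κ lam S' g g := by linarith
  have hexp : Real.exp (-(2 * α * δ / M)) * Real.exp (α * δ / M) ^ 2 = 1 := by
    rw [← Real.exp_nat_mul, ← Real.exp_add, Real.exp_eq_one_iff]; push_cast; ring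
  calc 1 / lam ^ 2 * ExpDecay.nodalForm κ lam S z z
      = 1 / lam ^ 2 * (Real.exp (-(2 * α * δ / M)) *
          (Real.exp (α * δ / M) ^ 2 * ExpDecay.nodalForm κ lam S z z)) := by
        rw [← mul_assoc (Real.exp _), hexp, one_mul]
    _ ≤ 1 / lam ^ 2 * (Real.exp (-(2 * α * δ / M)) *
          (2 * ExpDecay.nodalForm κ lam S' g g)) := by gcongr
    _ = _ := by ring
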